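/- Let $1\le p\le\infty$ and let $p'\in[1,\infty]$ be given by $\frac1p+\frac1{p'}=1$ (with $1/\infty=0$). Functions on $[0,1]$ are real- or complex-valued. For $1\le r<\infty$ put $X_r(0,1)=L^r(0,1)$, and let $X_\infty(0,1)=C([0,1])$ with the supremum norm. Functions on $[0,1]$ are extended $1$-periodically to $\mathbb R$ (from their restriction to $[0,1)$). Let $\Lambda\subset\mathbb N=\{0,1,2,\dots\}$ be a $[-1,1]$-Müntz–Szász sequence, that is, $0\in\Lambda$, $$\sum_{\lambda\in\Lambda,\ \lambda\neq0\text{ even}}\frac1\lambda=+\infty\quad\text{and}\quad\sum_{\lambda\in\Lambda,\ \lambda\text{ odd}}\frac1\lambda=+\infty ,$$ and let $\theta\in[0,1)$. Let $\mathcal T_{p,\Lambda,\theta}$ be the closed linear span in $X_p(0,1)$ of the functions $t\mapsto\cos^\lambda 2\pi(t-\theta)$, $\lambda\in\Lambda$, and let $$\mathcal T_{p,\Lambda,\theta}^\perp=\Bigl\{f\in X_{p'}(0,1):\int_0^1f(t)\cos^\lambda2\pi(t-\theta)\,dt=0\ \text{ for all }\lambda\in\Lambda\Bigr\}.$$ Then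 $$\mathcal T_{p,\Lambda,\theta}=\{f\in X_p(0,1): f(\theta+t)-f(\theta-t)=0\ \text{ for a.e. }t\in[0,1]\}$$ and $$\mathcal T_{p,\Lambda,\theta}^\perp=\{f\in X_{p'}(0,1): f(\theta+t)+f(\theta-t)=0\ \text{ for a.e. }t\in[0,1]\}.$$ -/

import Mathlib

open MeasureTheory
open scoped ENNReal unitInterval

/-- `Λ ⊆ ℕ` is an `[a,b]`-Müntz–Szász sequence. The series have non-negative terms, so
"the sum is `+∞`" is "not summable"; the exponent `0` never enters a series. -/
def IsMuntzSzasz (a b : ℝ) (Λ : Set ℕ) : Prop :=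
  ((a = 0 ∨ b = 0) →
    0 ∈ Λ ∧ ¬ Summable (fun n : {n : ℕ | n ∈ Λ ∧ n ≠ 0} => 1 / ((n : ℕ) : ℝ))) ∧
  ((0 < a ∨ b < 0) →
    ¬ Summable (fun n : {n : ℕ | n ∈ Λ ∧ n ≠ 0} => 1 / ((n : ℕ) : ℝ))) ∧
  ((a < 0 ∧ 0 < b) →
    0 ∈ Λ ∧
    ¬ Summable (fun n : {n : ℕ | n ∈ Λ ∧ n ≠ 0 ∧ Even n} => 1 / ((n : ℕ) : ℝ)) ∧
    ¬ Summable (fun n : {n : ℕ | n ∈ Λ ∧ Odd n} => 1 / ((n : ℕ) : ℝ)))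

open Classical in
/-- The space `X_p` on the unit interval `I = [0,1]` with Lebesgue measure: `L^p` for `p < ∞`, and
`C([0,1])` for `p = ∞`. The latter is realised as the space of the classes in `L^∞` of continuous
functions on `[0,1]`, where the norm of `L^∞` is the supremum norm. The topology is the one induced
by the norm of `L^p`. -/
noncomputable def XSpace (𝕜 : Type*) [RCLike 𝕜] (p : ℝ≥0∞) [Fact (1 ≤ p)] :
    Submodule 𝕜 (Lp 𝕜 p (volume : Measure I)) :=
  if p = ∞ then
    LinearMap.range (ContinuousMap.toLp (E := 𝕜) p (volume : Measure I) 𝕜).toLinearMap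
  else ⊤

theorem toLp_mem_XSpace (𝕜 : Type*) [RCLike 𝕜] (p : ℝ≥0∞) [Fact (1 ≤ p)] (f : C(I, 𝕜)) :
    ContinuousMap.toLp (E := 𝕜) p (volume : Measure I) 𝕜 f ∈ XSpace 𝕜 p := by
  unfold XSpace
  split_ifs
  · exact ⟨f, rfl⟩
  · trivial

/-- The function `t ↦ cos^n (2π(t - θ))` on `[0,1]`. -/
noncomputable def cosPow (𝕜 : Type*) [RCLike 𝕜] (θ : ℝ) (n : ℕ) : C(I, 𝕜) where
  toFun t := ((Real.cos (2 * Real.pi * ((t : ℝ) - θ)) ^ n : ℝ) : 𝕜)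
  continuous_toFun := RCLike.continuous_ofReal.comp (by fun_prop)

/-- The closed subspace of `X_p` spanned by the functions `cos^n (2π(t - θ))`, `n ∈ Λ`. -/
noncomputable def cosClosedSpan (𝕜 : Type*) [RCLike 𝕜] (p : ℝ≥0∞) [Fact (1 ≤ p)]
    (Λ : Set ℕ) (θ : ℝ) : Submodule 𝕜 (XSpace 𝕜 p) :=
  (Submodule.span 𝕜 {f : XSpace 𝕜 p | ∃ n ∈ Λ,
    f = ⟨ContinuousMap.toLp p volume 𝕜 (cosPow 𝕜 θ n),
      toLp_mem_XSpace 𝕜 p (cosPow 𝕜 θ n)⟩}).topologicalClosure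

/-- The set of all `f ∈ X_q` with `∫₀¹ f(t) cos^n (2π(t - θ)) dt = 0` for all `n ∈ Λ`. -/
def cosAnnihilator (𝕜 : Type*) [RCLike 𝕜] (q : ℝ≥0∞) [Fact (1 ≤ q)]
    (Λ : Set ℕ) (θ : ℝ) : Set (XSpace 𝕜 q) :=
  {f | ∀ n ∈ Λ, ∫ t : I, (f : Lp 𝕜 q (volume : Measure I)) t * cosPow 𝕜 θ n t = 0}

/-- The `1`-periodic extension to `ℝ` of (the restriction to `[0,1)` of) a function on `[0,1]`. -/
noncomputable def periodicExt {𝕜 : Type*} (f : I → 𝕜) (x : ℝ) : 𝕜 :=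
  f ⟨Int.fract x, unitInterval.fract_mem x⟩

/-- The functions in `X_p` that are even about `θ`. -/
def evenAbout (𝕜 : Type*) [RCLike 𝕜] (p : ℝ≥0∞) [Fact (1 ≤ p)] (θ : ℝ) : Set (XSpace 𝕜 p) :=
  {f | ∀ᵐ t : ℝ ∂(volume.restrict (Set.Icc 0 1)),
    periodicExt (f : Lp 𝕜 p (volume : Measure I)) (θ + t)
      - periodicExt (f : Lp 𝕜 p (volume : Measure I)) (θ - t) = 0}

/-- The functions in `X_p` that are odd about `θ`. -/
def oddAbout (𝕜 : Type*) [RCLike 𝕜] (p : ℝ≥0∞) [Fact (1 ≤ p)] (θ : ℝ) : Set (XSpace 𝕜 p) :=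
  {f | ∀ᵐ t : ℝ ∂(volume.restrict (Set.Icc 0 1)),
    periodicExt (f : Lp 𝕜 p (volume : Measure I)) (θ + t)
      + periodicExt (f : Lp 𝕜 p (volume : Measure I)) (θ - t) = 0}

/-! A function is even about θ exactly when, off a null set, it is a function of `y = cos 2π(t -
θ)`; `cosSectionI_cosMap` gives the factorization by a continuous section of the cosine. The claims
thus become statements about powers of `y` on `[-1,1]`. There the even and the odd exponents of Λ
each carry a Müntz theorem on `[0,1]`, extended by parity, and with Weierstrass they make the span
uniformly dense in the continuous functions of `y` (`comp_cosMap_mem_closure_span`). For `p < ∞`,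
such functions are dense in `L^p` of the law of `y`; for `p = ∞` the section keeps the factor
continuous. An annihilating `f` has symmetrization `f + f ∘ reflect θ`, again a function of `y`,
orthogonal to all smooth functions of `y`, hence zero. -/

/-! ### Müntz approximation of monomials -/

theorem pow_mul_integral_zpow {x : ℝ} (hx : 0 < x) {m l : ℕ} (h : m ≠ l) :
    x ^ l * ∫ t in x..1, t ^ ((m : ℤ) - 1 - l) = (x ^ l - x ^ m) / ((m : ℝ) - l) := by
  have h0 : (m : ℝ) - l ≠ 0 := sub_ne_zero.2 (by exact_mod_cast h)
  have hn : (0 : ℝ) ∉ Set.uIcc x 1 := by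
    intro h'
    have := h'.1
    exact absurd this (not_le.2 (lt_min hx one_pos))
  rw [integral_zpow (Or.inr ⟨by omega, hn⟩)]
  have e : (m : ℤ) - 1 - l + 1 = m - l := by ring
  have e' : (((m : ℤ) - 1 - l : ℤ) : ℝ) + 1 = m - l := by push_cast; ring
  rw [e, e', one_zpow, zpow_sub₀ hx.ne', zpow_natCast, zpow_natCast]
  field_simp

/-- One step of von Golitschek's construction. -/
theorem abs_pow_mul_integral_le {Q : ℝ → ℝ} {M : ℝ} {l : ℕ} (hl : 0 < l)
    (hQ : ∀ x ∈ Set.Ioc (0 : ℝ) 1, |Q x| ≤ M) {x : ℝ} (hx : x ∈ Set.Ioc (0 : ℝ) 1) :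
    |x ^ l * ∫ t in x..1, Q t * t ^ (-1 - (l : ℤ))| ≤ M / l := by
  have hM : 0 ≤ M := (abs_nonneg _).trans (hQ x hx)
  have hn : (0 : ℝ) ∉ Set.uIcc x 1 := by
    intro h'
    exact absurd h'.1 (not_le.2 (lt_min hx.1 one_pos))
  have hl' : (0 : ℝ) < l := by exact_mod_cast hl
  have key : ‖∫ t in x..1, Q t * t ^ (-1 - (l : ℤ))‖ ≤ ∫ t in x..1, M * t ^ (-1 - (l : ℤ)) := by
    refine intervalIntegral.norm_integral_le_of_norm_le hx.2 (ae_of_all _ fun t ht => ?_) ?_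
    · have ht0 : 0 < t := hx.1.trans ht.1
      rw [Real.norm_eq_abs, abs_mul, abs_of_pos (zpow_pos ht0 _)]
      exact mul_le_mul_of_nonneg_right (hQ t ⟨ht0, ht.2⟩) (zpow_pos ht0 _).le
    · exact (intervalIntegral.intervalIntegrable_zpow (Or.inr hn)).const_mul _
  rw [intervalIntegral.integral_const_mul] at key
  have e := pow_mul_integral_zpow hx.1 (m := 0) (l := l) hl.ne
  simp only [Nat.cast_zero, zero_sub, pow_zero] at e
  rw [abs_mul, abs_of_pos (pow_pos hx.1 l)]
  calc x ^ l * |∫ t in x..1, Q t * t ^ (-1 - (l : ℤ))|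
      ≤ x ^ l * (M * ∫ t in x..1, t ^ (-1 - (l : ℤ))) :=
        mul_le_mul_of_nonneg_left key (pow_pos hx.1 l).le
    _ = M * ((1 - x ^ l) / l) := by
        rw [mul_left_comm, e, div_neg, ← neg_div, neg_sub]
    _ ≤ M * (1 / l) := by
        gcongr
        linarith [pow_pos hx.1 l]
    _ = M / l := by ring

/-- Adding the exponent `l` replaces the error `Q` by `(l - q) x^l ∫ₓ¹ Q(t) t^(-1-l) dt`, which is
again `x^q` minus a combination of the allowed powers. Its bound gains the factor `(l - q)/l = 1 -
q/l`. -/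
theorem exists_abs_pow_sub_sum_le (q : ℕ) (S : Finset ℕ) (hS : ∀ m ∈ S, q < m) :
    ∃ a : ℕ → ℝ, ∀ x ∈ Set.Ioc (0 : ℝ) 1,
      |x ^ q - ∑ m ∈ S, a m * x ^ m| ≤ ∏ m ∈ S, (1 - (q : ℝ) / m) := by
  induction S using Finset.induction_on with
  | empty =>
    refine ⟨0, fun x hx => ?_⟩
    simpa [abs_of_pos (pow_pos hx.1 q)] using pow_le_one₀ hx.1.le hx.2
  | insert l S hl ih =>
    obtain ⟨a, ha⟩ := ih fun m hm => hS m (Finset.mem_insert_of_mem hm)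
    have hql : q < l := hS l (Finset.mem_insert_self _ _)
    have hql' : (q : ℝ) < l := by exact_mod_cast hql
    have hl0 : 0 < l := by omega
    have hl0' : (0 : ℝ) < l := by exact_mod_cast hl0
    -- The integral operator sends `x^q` to `x^q - x^l` and `a m * x^m` to `b m * (x^m - x^l)`; the
    -- coefficient of `x^l` collects the remainders.
    let b : ℕ → ℝ := fun m => -(((l : ℝ) - q) * a m / ((m : ℝ) - l))
    refine ⟨fun m => if m = l then 1 - ∑ m ∈ S, b m else b m, fun x hx => ?_⟩
    have key := abs_pow_mul_integral_le hl0 ha hx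
    have hne : ∀ m ∈ S, m ≠ l := fun m hm h => hl (h ▸ hm)
    have hn : (0 : ℝ) ∉ Set.uIcc x 1 := by
      intro h'
      exact absurd h'.1 (not_le.2 (lt_min hx.1 one_pos))
    have hint : ∀ m : ℕ, IntervalIntegrable (fun t : ℝ => t ^ ((m : ℤ) - 1 - l)) volume x 1 :=
      fun m => intervalIntegral.intervalIntegrable_zpow (Or.inr hn)
    have e1 : ∫ t in x..1, (t ^ q - ∑ m ∈ S, a m * t ^ m) * t ^ (-1 - (l : ℤ))
        = (∫ t in x..1, t ^ ((q : ℤ) - 1 - l))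
          - ∑ m ∈ S, a m * ∫ t in x..1, t ^ ((m : ℤ) - 1 - l) := by
      simp_rw [← intervalIntegral.integral_const_mul]
      rw [← intervalIntegral.integral_finsetSum fun m _ => (hint m).const_mul _,
        ← intervalIntegral.integral_sub (hint q)
          (by simpa only [Finset.sum_fn] using
            IntervalIntegrable.sum S fun m _ => (hint m).const_mul (a m))]
      refine intervalIntegral.integral_congr fun t ht => ?_
      have ht0 : t ≠ 0 := fun h => hn (h ▸ ht)
      have hz : ∀ m : ℕ, t ^ ((m : ℤ) - 1 - l) = t ^ m * t ^ (-1 - (l : ℤ)) := fun m => by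
        rw [← zpow_natCast, ← zpow_add₀ ht0]; congr 1; ring
      simp only [hz, sub_mul, Finset.sum_mul, mul_assoc]
    have e2 : x ^ q - ∑ m ∈ insert l S, (if m = l then 1 - ∑ m ∈ S, b m else b m) * x ^ m
        = ((l : ℝ) - q) * (x ^ l *
          ∫ t in x..1, (t ^ q - ∑ m ∈ S, a m * t ^ m) * t ^ (-1 - (l : ℤ))) := by
      rw [e1, mul_sub, Finset.mul_sum, pow_mul_integral_zpow hx.1 hql.ne,
        Finset.sum_insert hl, if_pos rfl]
      have h1 : ∀ m ∈ S, x ^ l * (a m * ∫ t in x..1, t ^ ((m : ℤ) - 1 - l))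
          = a m * ((x ^ l - x ^ m) / ((m : ℝ) - l)) := fun m hm => by
        rw [mul_left_comm, pow_mul_integral_zpow hx.1 (hne m hm)]
      rw [Finset.sum_congr rfl h1]
      have h2 : ∑ m ∈ S, (if m = l then 1 - ∑ m ∈ S, b m else b m) * x ^ m
          = ∑ m ∈ S, b m * x ^ m :=
        Finset.sum_congr rfl fun m hm => by rw [if_neg (hne m hm)]
      rw [h2, mul_sub, Finset.mul_sum]
      have h3 : ∑ m ∈ S, ((l : ℝ) - q) * (a m * ((x ^ l - x ^ m) / ((m : ℝ) - l)))
          = ∑ m ∈ S, b m * x ^ m - (∑ m ∈ S, b m) * x ^ l := by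
        rw [Finset.sum_mul, ← Finset.sum_sub_distrib]
        refine Finset.sum_congr rfl fun m _ => ?_
        simp only [b]
        ring
      rw [h3]
      have h4 : ((l : ℝ) - q) * ((x ^ l - x ^ q) / ((q : ℝ) - l)) = x ^ q - x ^ l := by
        have : (q : ℝ) - l ≠ 0 := by linarith
        field_simp
        ring
      rw [h4]
      ring
    rw [e2, abs_mul, abs_of_pos (sub_pos.2 hql'), Finset.prod_insert hl]
    calc ((l : ℝ) - q) * _ ≤ ((l : ℝ) - q) * ((∏ m ∈ S, (1 - (q : ℝ) / m)) / l) :=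
          mul_le_mul_of_nonneg_left key (by linarith)
      _ = (1 - (q : ℝ) / l) * ∏ m ∈ S, (1 - (q : ℝ) / m) := by
          field_simp

/-- Since `1 - u ≤ exp (-u)`, products bounded below by `ε` would bound every partial sum of `1/m`
by `-log ε / q`. -/
theorem exists_finset_prod_lt {A : Set ℕ} (hA : ¬ Summable fun n : A => 1 / ((n : ℕ) : ℝ))
    {q : ℕ} (hq : 0 < q) {ε : ℝ} (hε : 0 < ε) :
    ∃ S : Finset ℕ, (∀ m ∈ S, m ∈ A ∧ q < m) ∧ ∏ m ∈ S, (1 - (q : ℝ) / m) < ε := by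
  classical
  by_contra! hcon
  apply hA
  change Summable ((fun n : ℕ => 1 / (n : ℝ)) ∘ ((↑) : A → ℕ))
  rw [summable_subtype_iff_indicator]
  have hq' : (0 : ℝ) < q := by exact_mod_cast hq
  have hB : Summable ((A ∩ Set.Ioi q).indicator fun n : ℕ => 1 / (n : ℝ)) := by
    refine summable_of_sum_le (c := -Real.log ε / q)
      (fun n => Set.indicator_nonneg (fun _ _ => by positivity) n) fun u => ?_
    rw [Finset.sum_indicator_eq_sum_filter]
    set S := u.filter fun n => n ∈ A ∩ Set.Ioi q
    have h1 := hcon S fun m hm => (Finset.mem_filter.1 hm).2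
    have h2 : ∏ m ∈ S, (1 - (q : ℝ) / m) ≤ Real.exp (-(q * ∑ m ∈ S, 1 / (m : ℝ))) := by
      rw [Finset.mul_sum, ← Finset.sum_neg_distrib, Real.exp_sum]
      refine Finset.prod_le_prod (fun m hm => ?_) fun m hm => ?_
      · have : (q : ℝ) < m := by exact_mod_cast (Finset.mem_filter.1 hm).2.2
        rw [sub_nonneg, div_le_one (by linarith)]
        exact this.le
      · have := Real.add_one_le_exp (-(q * (1 / (m : ℝ))))
        refine le_trans (le_of_eq ?_) this
        ring
    rw [le_div_iff₀ hq']
    have := (Real.log_le_iff_le_exp hε).2 (h1.trans h2)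
    linarith
  refine (summable_congr_cofinite ?_).1 hB
  have : ∀ᶠ n : ℕ in Filter.cofinite, q < n := by
    rw [Nat.cofinite_eq_atTop]; exact Filter.eventually_gt_atTop q
  filter_upwards [this] with n hn
  by_cases h : n ∈ A <;> simp [Set.indicator, h, hn]

/-- Müntz approximation of a monomial on `[-1,1]` by monomials of the same parity. -/
theorem exists_abs_pow_sub_sum_lt {A : Set ℕ}
    (hA : ¬ Summable fun n : A => 1 / ((n : ℕ) : ℝ))
    {q : ℕ} (hq : 0 < q) (hpar : ∀ m ∈ A, (Even m ↔ Even q)) {ε : ℝ} (hε : 0 < ε) :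
    ∃ (S : Finset ℕ) (a : ℕ → ℝ), (∀ m ∈ S, m ∈ A) ∧ ∀ x ∈ Set.Icc (-1 : ℝ) 1,
      |x ^ q - ∑ m ∈ S, a m * x ^ m| < ε := by
  obtain ⟨S, hS, hlt⟩ := exists_finset_prod_lt hA hq hε
  obtain ⟨a, ha⟩ := exists_abs_pow_sub_sum_le q S fun m hm => (hS m hm).2
  refine ⟨S, a, fun m hm => (hS m hm).1, fun x hx => ?_⟩
  rcases lt_trichotomy x 0 with h | h | h
  · have h1 := (ha (-x) ⟨by linarith, by linarith [hx.1]⟩).trans_lt hlt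
    rcases Nat.even_or_odd q with hq2 | hq2
    · rwa [hq2.neg_pow, Finset.sum_congr rfl fun m hm => by
        rw [((hpar m (hS m hm).1).2 hq2).neg_pow]] at h1
    · have : ∀ m ∈ S, a m * (-x) ^ m = -(a m * x ^ m) := fun m hm => by
        have : Odd m := Nat.not_even_iff_odd.1 fun h' =>
          Nat.not_even_iff_odd.2 hq2 ((hpar m (hS m hm).1).1 h')
        rw [this.neg_pow]; ring
      rwa [hq2.neg_pow, Finset.sum_congr rfl this, Finset.sum_neg_distrib, ← neg_add',
        ← sub_eq_add_neg, abs_neg] at h1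
  · subst h
    rw [zero_pow hq.ne', Finset.sum_eq_zero fun m hm => by
      rw [zero_pow (hq.trans (hS m hm).2).ne', mul_zero]]
    simpa using hε
  · exact (ha x ⟨h, hx.2⟩).trans_lt hlt

/-! ### Reflection about θ and evenness on the unit interval -/

/-- The reflection `t ↦ 2θ - t` modulo `1`. -/
noncomputable def reflect (θ : ℝ) (t : I) : I :=
  ⟨Int.fract (2 * θ - t), unitInterval.fract_mem _⟩

theorem ae_unitInterval_ne_one : ∀ᵐ t : I, t ≠ 1 := Measure.ae_ne volume 1

theorem fract_coe_unitInterval {t : I} (ht : t ≠ 1) : Int.fract (t : ℝ) = t :=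
  Int.fract_eq_self.2 ⟨t.2.1, lt_of_le_of_ne t.2.2 fun h => ht (Subtype.ext h)⟩

theorem periodicExt_coe {α : Type*} (f : I → α) {t : I} (ht : t ≠ 1) :
    periodicExt f (t : ℝ) = f t := by
  unfold periodicExt
  congr 1
  exact Subtype.ext (fract_coe_unitInterval ht)

theorem periodicExt_two_mul_sub {α : Type*} (f : I → α) (θ : ℝ) (t : I) :
    periodicExt f (2 * θ - t) = f (reflect θ t) := rfl

theorem periodicExt_add_intCast {α : Type*} (f : I → α) (x : ℝ) (n : ℤ) :
    periodicExt f (x + n) = periodicExt f x := by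
  simp only [periodicExt, Int.fract_add_intCast]

theorem periodicExt_two_mul_sub_fract {α : Type*} (f : I → α) (θ x : ℝ) :
    periodicExt f (2 * θ - Int.fract x) = periodicExt f (2 * θ - x) := by
  rw [← periodicExt_add_intCast f (2 * θ - x) ⌊x⌋, ← Int.self_sub_floor]
  congr 1
  ring

theorem reflect_reflect (θ : ℝ) {t : I} (ht : t ≠ 1) : reflect θ (reflect θ t) = t := by
  have := periodicExt_two_mul_sub_fract (id : I → I) θ (2 * θ - t)
  rw [sub_sub_cancel, periodicExt_coe _ ht] at this
  exact this

theorem cosPow_reflect (𝕜 : Type*) [RCLike 𝕜] (θ : ℝ) (n : ℕ) (t : I) :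
    cosPow 𝕜 θ n (reflect θ t) = cosPow 𝕜 θ n t := by
  have : Real.cos (2 * Real.pi * (Int.fract (2 * θ - (t : ℝ)) - θ))
      = Real.cos (2 * Real.pi * (t - θ)) := by
    rw [← Int.self_sub_floor, ← Real.cos_neg (2 * Real.pi * (t - θ)),
      ← Real.cos_sub_int_mul_two_pi (-(2 * Real.pi * (t - θ))) ⌊2 * θ - (t : ℝ)⌋]
    congr 1
    ring
  change ((Real.cos (2 * Real.pi * (Int.fract (2 * θ - (t : ℝ)) - θ)) ^ n : ℝ) : 𝕜) = _
  rw [this]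
  rfl

theorem measurePreserving_coe_unitAddCircle :
    MeasurePreserving (fun t : I => ((t : ℝ) : UnitAddCircle)) := by
  have h1 : MeasurePreserving (Subtype.val : I → ℝ) volume
      (volume.restrict (Set.Ioc (0 : ℝ) (0 + 1))) := by
    rw [zero_add, restrict_Ioc_eq_restrict_Icc]
    exact measurePreserving_subtype_coe measurableSet_Icc
  exact (UnitAddCircle.measurePreserving_mk 0).comp h1

/-- The reflection is conjugate to `x ↦ 2θ - x` on the circle; `e` inverts the quotient map except
at the endpoint `1`, a null set. -/
theorem measurePreserving_reflect (θ : ℝ) : MeasurePreserving (reflect θ) := by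
  let e : UnitAddCircle → I := fun x =>
    ⟨(AddCircle.equivIco (1 : ℝ) 0 x : ℝ), by
      have := (AddCircle.equivIco (1 : ℝ) 0 x).2
      exact ⟨this.1, by simpa only [zero_add] using this.2.le⟩⟩
  have he : ∀ x : ℝ, e x = ⟨Int.fract x, unitInterval.fract_mem x⟩ := fun x =>
    Subtype.ext (by simp [e, AddCircle.coe_equivIco_mk_apply])
  have hem : Measurable e :=
    (measurable_subtype_coe.comp (AddCircle.measurableEquivIco (1 : ℝ) 0).measurable).subtype_mk
  have hmk := measurePreserving_coe_unitAddCircle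
  have hep : MeasurePreserving e := by
    refine ⟨hem, ?_⟩
    rw [← hmk.map_eq, Measure.map_map hem hmk.measurable]
    conv_rhs => rw [← Measure.map_id (μ := (volume : Measure I))]
    refine Measure.map_congr ?_
    filter_upwards [ae_unitInterval_ne_one] with t ht
    simp only [Function.comp_apply, he]
    exact Subtype.ext (fract_coe_unitInterval ht)
  have := hep.comp ((Measure.measurePreserving_sub_left volume
    ((2 * θ : ℝ) : UnitAddCircle)).comp hmk)
  convert this using 1
  funext t
  exact (he (2 * θ - t)).symm

theorem ae_restrict_Icc_iff_of_periodic {P : ℝ → Prop} (hP : ∀ (x : ℝ) (n : ℤ), P (x + n) ↔ P x) :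
    (∀ᵐ x ∂(volume.restrict (Set.Icc (0 : ℝ) 1)), P x) ↔ ∀ᵐ x : ℝ, P x := by
  refine ⟨fun h => ?_, ae_restrict_of_ae⟩
  rw [ae_restrict_iff' measurableSet_Icc] at h
  have h2 : ∀ᵐ x : ℝ, ∀ n : ℤ, x - n ∈ Set.Icc (0 : ℝ) 1 → P (x - n) :=
    ae_all_iff.2 fun n =>
      (measurePreserving_sub_right volume (n : ℝ)).quasiMeasurePreserving.ae h
  filter_upwards [h2] with x hx
  have := hx ⌊x⌋ (by rw [Int.self_sub_floor]; exact unitInterval.fract_mem x)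
  rwa [← hP _ ⌊x⌋, sub_add_cancel] at this

theorem ae_restrict_Icc_add_iff_of_periodic {P : ℝ → Prop}
    (hP : ∀ (x : ℝ) (n : ℤ), P (x + n) ↔ P x) (θ : ℝ) :
    (∀ᵐ x ∂(volume.restrict (Set.Icc (0 : ℝ) 1)), P (θ + x)) ↔ ∀ᵐ t : I, P t := by
  rw [ae_restrict_Icc_iff_of_periodic (P := fun x => P (θ + x)) fun x n => by
    rw [← add_assoc, hP]]
  have h1 : (∀ᵐ t : I, P t) ↔ ∀ᵐ x : ℝ, P x := by
    rw [← ae_restrict_Icc_iff_of_periodic hP]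
    exact (ae_restrict_iff_subtype measurableSet_Icc).symm
  rw [h1]
  refine ⟨fun h => ?_, fun h =>
    (measurePreserving_add_left volume θ).quasiMeasurePreserving.ae h⟩
  have := (measurePreserving_add_left volume (-θ)).quasiMeasurePreserving.ae h
  simpa using this

section
variable {𝕜 : Type*} [RCLike 𝕜] {p : ℝ≥0∞} [Fact (1 ≤ p)] {θ : ℝ}

theorem mem_evenAbout_iff (f : XSpace 𝕜 p) :
    f ∈ evenAbout 𝕜 p θ ↔ ∀ᵐ t : I, (f : Lp 𝕜 p (volume : Measure I)) (reflect θ t)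
      = (f : Lp 𝕜 p (volume : Measure I)) t := by
  set F : I → 𝕜 := ⇑(f : Lp 𝕜 p (volume : Measure I)) with hF
  have h := ae_restrict_Icc_add_iff_of_periodic
    (P := fun x => periodicExt F x - periodicExt F (2 * θ - x) = 0) (fun x n => by
      rw [periodicExt_add_intCast, ← periodicExt_add_intCast F (2 * θ - (x + n)) n,
        show 2 * θ - (x + n) + n = 2 * θ - x by ring]) θ
  simp only [show ∀ x : ℝ, 2 * θ - (θ + x) = θ - x from fun x => by ring] at h
  refine h.trans (Filter.eventually_congr ?_)
  filter_upwards [ae_unitInterval_ne_one] with t ht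
  rw [periodicExt_coe _ ht, periodicExt_two_mul_sub, sub_eq_zero, eq_comm]

theorem mem_oddAbout_iff (f : XSpace 𝕜 p) :
    f ∈ oddAbout 𝕜 p θ ↔ ∀ᵐ t : I, (f : Lp 𝕜 p (volume : Measure I)) (reflect θ t)
      = -(f : Lp 𝕜 p (volume : Measure I)) t := by
  set F : I → 𝕜 := ⇑(f : Lp 𝕜 p (volume : Measure I)) with hF
  have h := ae_restrict_Icc_add_iff_of_periodic
    (P := fun x => periodicExt F x + periodicExt F (2 * θ - x) = 0) (fun x n => by
      rw [periodicExt_add_intCast, ← periodicExt_add_intCast F (2 * θ - (x + n)) n,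
        show 2 * θ - (x + n) + n = 2 * θ - x by ring]) θ
  simp only [show ∀ x : ℝ, 2 * θ - (θ + x) = θ - x from fun x => by ring] at h
  refine h.trans (Filter.eventually_congr ?_)
  filter_upwards [ae_unitInterval_ne_one] with t ht
  rw [periodicExt_coe _ ht, periodicExt_two_mul_sub, add_comm, add_eq_zero_iff_eq_neg]

end

/-! ### Even functions as functions of the cosine -/

/-- A continuous right inverse, modulo reflection, of `t ↦ cos (2π(t - θ))`. -/
noncomputable def cosSection (θ y : ℝ) : ℝ :=
  -- The half period is taken on the side of θ where it stays inside `[0,1)`, so no reduction modulo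
  -- `1` breaks continuity.
  if θ < 1 / 2 then θ + Real.arccos y / (2 * Real.pi) else θ - Real.arccos y / (2 * Real.pi)

theorem continuous_cosSection (θ : ℝ) : Continuous (cosSection θ) := by
  unfold cosSection
  split_ifs
  · exact continuous_const.add (Real.continuous_arccos.div_const _)
  · exact continuous_const.sub (Real.continuous_arccos.div_const _)

theorem cosSection_mem {θ : ℝ} (hθ : θ ∈ Set.Ico (0 : ℝ) 1) (y : ℝ) :
    cosSection θ y ∈ Set.Ico (0 : ℝ) 1 := by
  have h1 : 0 ≤ Real.arccos y / (2 * Real.pi) :=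
    div_nonneg (Real.arccos_nonneg y) (by positivity)
  have h2 : Real.arccos y / (2 * Real.pi) ≤ 1 / 2 := by
    rw [div_le_iff₀ (by positivity)]
    linarith [Real.arccos_le_pi y]
  have := hθ.1
  have := hθ.2
  unfold cosSection
  split_ifs
  · constructor <;> linarith
  · constructor <;> linarith

theorem cosSection_cos (θ x : ℝ) : ∃ k : ℤ,
    cosSection θ (Real.cos (2 * Real.pi * (x - θ))) = x + k ∨
    cosSection θ (Real.cos (2 * Real.pi * (x - θ))) = 2 * θ - x + k := by
  set u := Real.arccos (Real.cos (2 * Real.pi * (x - θ))) with hu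
  have hcos : Real.cos u = Real.cos (2 * Real.pi * (x - θ)) :=
    Real.cos_arccos (Real.neg_one_le_cos _) (Real.cos_le_one _)
  have hpi : (2 : ℝ) * Real.pi ≠ 0 := by positivity
  obtain ⟨k, hk⟩ := Real.cos_eq_cos_iff.1 hcos
  have hk' : u / (2 * Real.pi) = (x - θ) - k ∨ u / (2 * Real.pi) = k - (x - θ) := by
    rcases hk with hk | hk
    · left; rw [div_eq_iff hpi]; linarith
    · right; rw [div_eq_iff hpi]; linarith
  unfold cosSection
  rw [← hu]
  split_ifs
  · rcases hk' with h | h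
    · exact ⟨-k, Or.inl (by rw [h]; push_cast; ring)⟩
    · exact ⟨k, Or.inr (by rw [h]; ring)⟩
  · rcases hk' with h | h
    · exact ⟨k, Or.inr (by rw [h]; ring)⟩
    · exact ⟨-k, Or.inl (by rw [h]; push_cast; ring)⟩

/-- `cosSection` as a map into the unit interval. -/
noncomputable def cosSectionI {θ : ℝ} (hθ : θ ∈ Set.Ico (0 : ℝ) 1) : C(ℝ, I) where
  toFun y := ⟨cosSection θ y, Set.Ico_subset_Icc_self (cosSection_mem hθ y)⟩
  continuous_toFun := (continuous_cosSection θ).subtype_mk _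

/-- The function `t ↦ cos (2π(t - θ))` on the unit interval. -/
noncomputable def cosMap (θ : ℝ) : C(I, ℝ) where
  toFun t := Real.cos (2 * Real.pi * ((t : ℝ) - θ))
  continuous_toFun := by fun_prop

theorem cosPow_apply (𝕜 : Type*) [RCLike 𝕜] (θ : ℝ) (n : ℕ) (t : I) :
    cosPow 𝕜 θ n t = (cosMap θ t : 𝕜) ^ n := RCLike.ofReal_pow _ _

theorem cosMap_mem (θ : ℝ) (t : I) : cosMap θ t ∈ Set.Icc (-1 : ℝ) 1 :=
  Real.cos_mem_Icc _

/-- The section returns `t` or its reflection modulo `1`. Symmetry is needed only at `t` itself, so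
the lemma applies to functions even almost everywhere. -/
theorem cosSectionI_cosMap {α : Type*} {θ : ℝ} (hθ : θ ∈ Set.Ico (0 : ℝ) 1) (f : I → α) {t : I}
    (ht : t ≠ 1) (h : f (reflect θ t) = f t) : f (cosSectionI hθ (cosMap θ t)) = f t := by
  set s := cosSectionI hθ (cosMap θ t) with hs
  have hs1 : s ≠ 1 := fun h' =>
    (cosSection_mem hθ (cosMap θ t)).2.ne (congrArg (Subtype.val : I → ℝ) h')
  rw [← periodicExt_coe f hs1]
  obtain ⟨k, hk | hk⟩ := cosSection_cos θ t
  · have : (s : ℝ) = t + k := hk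
    rw [this, periodicExt_add_intCast, periodicExt_coe f ht]
  · have : (s : ℝ) = 2 * θ - t + k := hk
    rw [this, periodicExt_add_intCast, periodicExt_two_mul_sub, h]

/-! ### Uniform density in the continuous functions of the cosine -/

section
variable {𝕜 : Type*} [RCLike 𝕜] {Λ : Set ℕ} {θ : ℝ}

theorem cosPow_mem_closure_span (hΛ : IsMuntzSzasz (-1) 1 Λ) (q : ℕ) :
    cosPow 𝕜 θ q ∈ (Submodule.span 𝕜 (cosPow 𝕜 θ '' Λ)).topologicalClosure := by
  obtain ⟨h0, heven, hodd⟩ := hΛ.2.2 ⟨by norm_num, by norm_num⟩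
  rcases Nat.eq_zero_or_pos q with rfl | hq
  · exact Submodule.le_topologicalClosure _ (Submodule.subset_span ⟨0, h0, rfl⟩)
  have key : ∀ ε > (0 : ℝ), ∃ (S : Finset ℕ) (a : ℕ → ℝ), (∀ m ∈ S, m ∈ Λ) ∧
      ∀ x ∈ Set.Icc (-1 : ℝ) 1, |x ^ q - ∑ m ∈ S, a m * x ^ m| < ε := by
    intro ε hε
    rcases Nat.even_or_odd q with hq2 | hq2
    · obtain ⟨S, a, hS, h⟩ := exists_abs_pow_sub_sum_lt heven hq
        (fun m hm => iff_of_true hm.2.2 hq2) hε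
      exact ⟨S, a, fun m hm => (hS m hm).1, h⟩
    · obtain ⟨S, a, hS, h⟩ := exists_abs_pow_sub_sum_lt hodd hq
        (fun m hm => iff_of_false (Nat.not_even_iff_odd.2 hm.2) (Nat.not_even_iff_odd.2 hq2)) hε
      exact ⟨S, a, fun m hm => (hS m hm).1, h⟩
  refine Metric.mem_closure_iff.2 fun ε hε => ?_
  obtain ⟨S, a, hS, h⟩ := key ε hε
  refine ⟨∑ m ∈ S, (a m : 𝕜) • cosPow 𝕜 θ m,
    Submodule.sum_mem _ fun m hm => Submodule.smul_mem _ _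
      (Submodule.subset_span ⟨m, hS m hm, rfl⟩), ?_⟩
  rw [ContinuousMap.dist_lt_iff hε]
  intro t
  have := h _ (cosMap_mem θ t)
  rw [dist_eq_norm, ContinuousMap.sum_apply]
  simp only [ContinuousMap.smul_apply, cosPow_apply, smul_eq_mul]
  have e : (cosMap θ t : 𝕜) ^ q - ∑ m ∈ S, (a m : 𝕜) * (cosMap θ t : 𝕜) ^ m
      = ((cosMap θ t ^ q - ∑ m ∈ S, a m * cosMap θ t ^ m : ℝ) : 𝕜) := by
    push_cast
    rfl
  rwa [e, RCLike.norm_ofReal]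

theorem ofReal_comp_cosMap_mem_closure_span (hΛ : IsMuntzSzasz (-1) 1 Λ) {φ : ℝ → ℝ}
    (hφ : Continuous φ) {F : C(I, 𝕜)} (hF : ∀ t, F t = (φ (cosMap θ t) : 𝕜)) :
    F ∈ (Submodule.span 𝕜 (cosPow 𝕜 θ '' Λ)).topologicalClosure := by
  set V := (Submodule.span 𝕜 (cosPow 𝕜 θ '' Λ)).topologicalClosure
  have hV : IsClosed (V : Set C(I, 𝕜)) := Submodule.isClosed_topologicalClosure _
  rw [← SetLike.mem_coe, ← hV.closure_eq]
  refine Metric.mem_closure_iff.2 fun ε hε => ?_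
  obtain ⟨P, hP⟩ := exists_polynomial_near_of_continuousOn (-1) 1 φ hφ.continuousOn ε hε
  refine ⟨∑ i ∈ Finset.range (P.natDegree + 1), (P.coeff i : 𝕜) • cosPow 𝕜 θ i,
    Submodule.sum_mem _ fun i _ => Submodule.smul_mem _ _ (cosPow_mem_closure_span hΛ i), ?_⟩
  rw [ContinuousMap.dist_lt_iff hε]
  intro t
  have := hP _ (cosMap_mem θ t)
  rw [dist_comm, dist_eq_norm, ContinuousMap.sum_apply, hF]
  simp only [ContinuousMap.smul_apply, cosPow_apply, smul_eq_mul]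
  have e : ∑ i ∈ Finset.range (P.natDegree + 1), (P.coeff i : 𝕜) * (cosMap θ t : 𝕜) ^ i
      - (φ (cosMap θ t) : 𝕜) = ((P.eval (cosMap θ t) - φ (cosMap θ t) : ℝ) : 𝕜) := by
    rw [Polynomial.eval_eq_sum_range]
    push_cast
    rfl
  rwa [e, RCLike.norm_ofReal]

/-- Continuous functions of `cos (2π(t - θ))` are uniform limits of linear combinations of the
powers with exponents in `Λ`. -/
theorem comp_cosMap_mem_closure_span (hΛ : IsMuntzSzasz (-1) 1 Λ) (φ : C(ℝ, 𝕜)) :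
    φ.comp (cosMap θ) ∈ (Submodule.span 𝕜 (cosPow 𝕜 θ '' Λ)).topologicalClosure := by
  let R : C(I, 𝕜) := ⟨fun t => (RCLike.re (φ (cosMap θ t)) : 𝕜), by fun_prop⟩
  let M : C(I, 𝕜) := ⟨fun t => (RCLike.im (φ (cosMap θ t)) : 𝕜), by fun_prop⟩
  have e : φ.comp (cosMap θ) = R + (RCLike.I : 𝕜) • M := by
    ext t
    simp only [ContinuousMap.comp_apply, ContinuousMap.add_apply, ContinuousMap.smul_apply,
      smul_eq_mul, R, M, ContinuousMap.coe_mk]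
    rw [mul_comm, RCLike.re_add_im]
  rw [e]
  refine add_mem ?_ (Submodule.smul_mem _ _ ?_)
  · exact ofReal_comp_cosMap_mem_closure_span hΛ
      (φ := fun y => RCLike.re (φ y)) (by fun_prop) fun _ => rfl
  · exact ofReal_comp_cosMap_mem_closure_span hΛ
      (φ := fun y => RCLike.im (φ y)) (by fun_prop) fun _ => rfl

/-- Integration against an `L^1` function is continuous for the supremum norm, so its kernel is
closed; no duality between `L^p` spaces is needed. -/
theorem integral_mul_eq_zero_of_mem_closure_span {f : I → 𝕜} (hf : Integrable f)
    (h : ∀ n ∈ Λ, ∫ t : I, f t * cosPow 𝕜 θ n t = 0) {G : C(I, 𝕜)}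
    (hG : G ∈ (Submodule.span 𝕜 (cosPow 𝕜 θ '' Λ)).topologicalClosure) :
    ∫ t : I, f t * G t = 0 := by
  have hint : ∀ G : C(I, 𝕜), Integrable fun t => f t * G t := fun G =>
    hf.mul_bdd (c := ‖G‖) G.continuous.aestronglyMeasurable
      (ae_of_all _ fun t => G.norm_coe_le_norm t)
  let L : C(I, 𝕜) →ₗ[𝕜] 𝕜 :=
    { toFun := fun G => ∫ t : I, f t * G t
      map_add' := fun G H => by
        rw [← integral_add (hint G) (hint H)]
        simp only [ContinuousMap.add_apply, mul_add]
      map_smul' := fun c G => by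
        rw [RingHom.id_apply, smul_eq_mul, ← integral_const_mul]
        simp only [ContinuousMap.smul_apply, smul_eq_mul, mul_left_comm] }
  let L' : C(I, 𝕜) →L[𝕜] 𝕜 := L.mkContinuous (∫ t : I, ‖f t‖) fun G => by
    rw [← integral_mul_const]
    refine norm_integral_le_of_norm_le (hf.norm.mul_const _) (ae_of_all _ fun t => ?_)
    rw [norm_mul]
    exact mul_le_mul_of_nonneg_left (G.norm_coe_le_norm t) (norm_nonneg _)
  have : (Submodule.span 𝕜 (cosPow 𝕜 θ '' Λ)).topologicalClosure ≤ LinearMap.ker L'.toLinearMap := by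
    refine Submodule.topologicalClosure_minimal _ (Submodule.span_le.2 ?_) L'.isClosed_ker
    rintro _ ⟨n, hn, rfl⟩
    exact h n hn
  exact this hG

/-! ### The closed span in `X_p` -/

/-- The inclusion of `C([0,1])` into `X_p`. -/
noncomputable def toXSpace (𝕜 : Type*) [RCLike 𝕜] (p : ℝ≥0∞) [Fact (1 ≤ p)] :
    C(I, 𝕜) →L[𝕜] XSpace 𝕜 p :=
  (ContinuousMap.toLp (E := 𝕜) p (volume : Measure I) 𝕜).codRestrict _ (toLp_mem_XSpace 𝕜 p)

theorem coe_toXSpace_ae (p : ℝ≥0∞) [Fact (1 ≤ p)] (F : C(I, 𝕜)) :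
    ⇑(toXSpace 𝕜 p F : Lp 𝕜 p (volume : Measure I)) =ᵐ[volume] F :=
  ContinuousMap.coeFn_toLp (E := 𝕜) (𝕜 := 𝕜) (p := p) volume F

theorem toXSpace_mem_cosClosedSpan (p : ℝ≥0∞) [Fact (1 ≤ p)] {F : C(I, 𝕜)}
    (hF : F ∈ (Submodule.span 𝕜 (cosPow 𝕜 θ '' Λ)).topologicalClosure) :
    toXSpace 𝕜 p F ∈ cosClosedSpan 𝕜 p Λ θ := by
  have : (Submodule.span 𝕜 (cosPow 𝕜 θ '' Λ)).topologicalClosure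
      ≤ (cosClosedSpan 𝕜 p Λ θ).comap (toXSpace 𝕜 p).toLinearMap := by
    refine Submodule.topologicalClosure_minimal _ (Submodule.span_le.2 ?_)
      ((Submodule.isClosed_topologicalClosure _).preimage (toXSpace 𝕜 p).continuous)
    rintro _ ⟨n, hn, rfl⟩
    exact Submodule.le_topologicalClosure _ (Submodule.subset_span ⟨n, hn, rfl⟩)
  exact this hF

/-- The even functions are the kernel of the continuous map `f ↦ f ∘ reflect θ - f`, and the
generators lie in it. -/
theorem cosClosedSpan_subset_evenAbout (p : ℝ≥0∞) [Fact (1 ≤ p)] :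
    (cosClosedSpan 𝕜 p Λ θ : Set (XSpace 𝕜 p)) ⊆ evenAbout 𝕜 p θ := by
  let C := Lp.compMeasurePreservingₗᵢ 𝕜 (E := 𝕜) (p := p) (reflect θ) (measurePreserving_reflect θ)
  let D : XSpace 𝕜 p →L[𝕜] Lp 𝕜 p (volume : Measure I) :=
    (C.toContinuousLinearMap - ContinuousLinearMap.id 𝕜 _).comp (XSpace 𝕜 p).subtypeL
  have hC : ∀ f : Lp 𝕜 p (volume : Measure I), ⇑(C f) =ᵐ[volume] fun t => f (reflect θ t) :=
    fun f => Lp.coeFn_compMeasurePreserving f (measurePreserving_reflect θ)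
  have hD : ∀ f : XSpace 𝕜 p, D f = 0 ↔ f ∈ evenAbout 𝕜 p θ := fun f => by
    rw [mem_evenAbout_iff]
    change C f - (f : Lp 𝕜 p (volume : Measure I)) = 0 ↔ _
    rw [sub_eq_zero, Lp.ext_iff]
    refine Filter.eventually_congr ?_
    filter_upwards [hC f] with t ht
    rw [ht]
  have : cosClosedSpan 𝕜 p Λ θ ≤ LinearMap.ker D.toLinearMap := by
    refine Submodule.topologicalClosure_minimal _ (Submodule.span_le.2 ?_) D.isClosed_ker
    rintro _ ⟨n, hn, rfl⟩
    refine (hD _).2 ((mem_evenAbout_iff _).2 ?_)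
    have h := coe_toXSpace_ae p (cosPow 𝕜 θ n)
    filter_upwards [h, (measurePreserving_reflect θ).quasiMeasurePreserving.ae h] with t h1 h2
    exact h2.trans ((cosPow_reflect 𝕜 θ n t).trans h1.symm)
  exact fun f hf => (hD f).1 (this hf)

theorem evenAbout_subset_cosClosedSpan (p : ℝ≥0∞) [Fact (1 ≤ p)]
    (hΛ : IsMuntzSzasz (-1) 1 Λ) (hθ : θ ∈ Set.Ico (0 : ℝ) 1) :
    evenAbout 𝕜 p θ ⊆ (cosClosedSpan 𝕜 p Λ θ : Set (XSpace 𝕜 p)) := by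
  intro f hf
  rw [mem_evenAbout_iff] at hf
  have hV : ∀ φ : C(ℝ, 𝕜), toXSpace 𝕜 p (φ.comp (cosMap θ)) ∈ cosClosedSpan 𝕜 p Λ θ :=
    fun φ => toXSpace_mem_cosClosedSpan p (comp_cosMap_mem_closure_span hΛ φ)
  by_cases hp : p = ∞
  · obtain ⟨F, hF⟩ : ∃ F : C(I, 𝕜), ContinuousMap.toLp (E := 𝕜) p volume 𝕜 F = f := by
      have hX : XSpace 𝕜 p = LinearMap.range
          (ContinuousMap.toLp (E := 𝕜) p (volume : Measure I) 𝕜).toLinearMap := if_pos hp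
      exact hX.le f.2
    have hFf : toXSpace 𝕜 p F = f := Subtype.ext hF
    have hae := coe_toXSpace_ae p F
    rw [hFf] at hae
    have e : toXSpace 𝕜 p ((F.comp (cosSectionI hθ)).comp (cosMap θ)) = f := by
      refine Subtype.ext (Lp.ext ?_)
      filter_upwards [coe_toXSpace_ae p ((F.comp (cosSectionI hθ)).comp (cosMap θ)), hae,
        (measurePreserving_reflect θ).quasiMeasurePreserving.ae hae, hf,
        ae_unitInterval_ne_one] with t h1 h2 h3 h4 h5
      rw [h1, h2]
      exact cosSectionI_cosMap hθ F h5 (by rw [← h3, h4, h2])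
    rw [← e]
    exact hV _
  · have hclosed : IsClosed (cosClosedSpan 𝕜 p Λ θ : Set (XSpace 𝕜 p)) :=
      Submodule.isClosed_topologicalClosure _
    rw [← hclosed.closure_eq]
    refine EMetric.mem_closure_iff.2 fun ε hε => ?_
    set g : Lp 𝕜 p (volume : Measure I) := (f : Lp 𝕜 p (volume : Measure I)) with hg
    let h : ℝ → 𝕜 := fun y => g (cosSectionI hθ y)
    have hm : StronglyMeasurable h :=
      (Lp.stronglyMeasurable g).comp_measurable (cosSectionI hθ).continuous.measurable
    have hcm : AEMeasurable (cosMap θ) (volume : Measure I) :=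
      (cosMap θ).continuous.measurable.aemeasurable
    have hhg : h ∘ cosMap θ =ᵐ[volume] g := by
      filter_upwards [hf, ae_unitInterval_ne_one] with t h1 h2
      exact cosSectionI_cosMap hθ g h2 h1
    have hLp : MemLp h p (Measure.map (cosMap θ) volume) :=
      (memLp_map_measure_iff hm.aestronglyMeasurable hcm).2 ((memLp_congr_ae hhg).2 (Lp.memLp g))
    have : IsFiniteMeasure (Measure.map (cosMap θ) (volume : Measure I)) := inferInstance
    obtain ⟨φ, hφ, -⟩ := hLp.exists_boundedContinuous_eLpNorm_sub_le hp
      (ENNReal.half_pos hε.ne').ne'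
    refine ⟨_, hV φ.toContinuousMap, ?_⟩
    have hlt : eLpNorm (h - ⇑φ) p (Measure.map (cosMap θ) volume) < ε ∨ ε = ∞ := by
      by_cases h' : ε = ∞
      · exact Or.inr h'
      · exact Or.inl (hφ.trans_lt (ENNReal.half_lt_self hε.ne' h'))
    rcases hlt with hlt | rfl
    · rw [eLpNorm_map_measure (hm.aestronglyMeasurable.sub
        φ.continuous.aestronglyMeasurable) hcm] at hlt
      rw [Subtype.edist_eq, Lp.edist_def]
      refine lt_of_eq_of_lt (eLpNorm_congr_ae ?_) hlt
      filter_upwards [hhg, coe_toXSpace_ae p (φ.toContinuousMap.comp (cosMap θ))] with t h1 h2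
      simp only [Pi.sub_apply, Function.comp_apply] at h1 ⊢
      rw [h2, h1]
      rfl
    · exact edist_lt_top _ _

/-! ### The annihilator -/

theorem oddAbout_subset_cosAnnihilator (q : ℝ≥0∞) [Fact (1 ≤ q)] :
    oddAbout 𝕜 q θ ⊆ cosAnnihilator 𝕜 q Λ θ := by
  intro f hf n _
  rw [mem_oddAbout_iff] at hf
  set g : Lp 𝕜 q (volume : Measure I) := (f : Lp 𝕜 q (volume : Measure I))
  have hmp := measurePreserving_reflect θ
  have h1 : ∫ t : I, g (reflect θ t) * cosPow 𝕜 θ n (reflect θ t)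
      = ∫ t : I, g t * cosPow 𝕜 θ n t := by
    rw [← integral_map (φ := reflect θ) (f := fun t => g t * cosPow 𝕜 θ n t)
      hmp.measurable.aemeasurable, hmp.map_eq]
    exact ((Lp.stronglyMeasurable g).mul
      (cosPow 𝕜 θ n).continuous.stronglyMeasurable).aestronglyMeasurable
  have h2 : ∫ t : I, g (reflect θ t) * cosPow 𝕜 θ n (reflect θ t)
      = -∫ t : I, g t * cosPow 𝕜 θ n t := by
    rw [← integral_neg]
    refine integral_congr_ae ?_
    filter_upwards [hf] with t ht
    rw [ht, cosPow_reflect, neg_mul]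
  exact self_eq_neg.1 (h1.symm.trans h2)

theorem cosAnnihilator_subset_oddAbout (q : ℝ≥0∞) [Fact (1 ≤ q)]
    (hΛ : IsMuntzSzasz (-1) 1 Λ) (hθ : θ ∈ Set.Ico (0 : ℝ) 1) :
    cosAnnihilator 𝕜 q Λ θ ⊆ oddAbout 𝕜 q θ := by
  intro f hf
  rw [mem_oddAbout_iff]
  set g : Lp 𝕜 q (volume : Measure I) := (f : Lp 𝕜 q (volume : Measure I))
  have hmp := measurePreserving_reflect θ
  have hgi : Integrable g := (Lp.memLp g).integrable Fact.out
  have hgs := Lp.stronglyMeasurable g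
  -- The symmetrization annihilates the same powers, as these are even, and it factors through the
  -- cosine; oddness of `g` means `k = 0`.
  let k : I → 𝕜 := fun t => g t + g (reflect θ t)
  have hki : Integrable k := hgi.add (hmp.integrable_comp_of_integrable hgi)
  have hks : StronglyMeasurable k := hgs.add (hgs.comp_measurable hmp.measurable)
  have hk : ∀ n ∈ Λ, ∫ t : I, k t * cosPow 𝕜 θ n t = 0 := by
    intro n hn
    have hG : Integrable fun t => g t * cosPow 𝕜 θ n t :=
      hgi.mul_bdd (c := ‖cosPow 𝕜 θ n‖) (cosPow 𝕜 θ n).continuous.aestronglyMeasurable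
        (ae_of_all _ fun t => (cosPow 𝕜 θ n).norm_coe_le_norm t)
    have h0 : ∫ t : I, g t * cosPow 𝕜 θ n t = 0 := hf n hn
    have h1 : ∫ t : I, g (reflect θ t) * cosPow 𝕜 θ n (reflect θ t)
        = ∫ t : I, g t * cosPow 𝕜 θ n t := by
      rw [← integral_map (φ := reflect θ) (f := fun t => g t * cosPow 𝕜 θ n t)
        hmp.measurable.aemeasurable, hmp.map_eq]
      exact (hgs.mul (cosPow 𝕜 θ n).continuous.stronglyMeasurable).aestronglyMeasurable
    have h2 := integral_add hG (hmp.integrable_comp_of_integrable hG)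
    simp only [Function.comp_apply] at h2
    rw [h1, h0, add_zero] at h2
    rw [← h2]
    simp only [k, add_mul, cosPow_reflect]
  let h : ℝ → 𝕜 := fun y => k (cosSectionI hθ y)
  have hm : StronglyMeasurable h :=
    hks.comp_measurable (cosSectionI hθ).continuous.measurable
  have hcm : AEMeasurable (cosMap θ) (volume : Measure I) :=
    (cosMap θ).continuous.measurable.aemeasurable
  have hhk : h ∘ cosMap θ =ᵐ[volume] k := by
    filter_upwards [ae_unitInterval_ne_one] with t ht
    refine cosSectionI_cosMap hθ k ht ?_
    simp only [k]
    rw [reflect_reflect θ ht, add_comm]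
  have hint : Integrable h (Measure.map (cosMap θ) volume) :=
    (integrable_map_measure hm.aestronglyMeasurable hcm).2 (hki.congr hhk.symm)
  have hzero : ∀ᵐ y ∂(Measure.map (cosMap θ) volume), h y = 0 := by
    refine ae_eq_zero_of_integral_contDiff_smul_eq_zero hint.locallyIntegrable fun φ hφ _ => ?_
    rw [integral_map (f := fun y => φ y • h y) hcm
      (hφ.continuous.aestronglyMeasurable.smul hm.aestronglyMeasurable)]
    let Φ : C(ℝ, 𝕜) := ⟨fun y => (φ y : 𝕜), RCLike.continuous_ofReal.comp hφ.continuous⟩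
    rw [← integral_mul_eq_zero_of_mem_closure_span hki hk
      (comp_cosMap_mem_closure_span (θ := θ) hΛ Φ)]
    refine integral_congr_ae ?_
    filter_upwards [hhk] with t ht
    have ht' : h (cosMap θ t) = k t := ht
    rw [ht', RCLike.real_smul_eq_coe_mul, mul_comm]
    rfl
  filter_upwards [ae_of_ae_map hcm hzero, hhk] with t h1 h2
  have h3 : k t = 0 := h2.symm.trans h1
  exact eq_neg_of_add_eq_zero_right h3

end

theorem lemma4p1 (𝕜 : Type*) [RCLike 𝕜] (p q : ℝ≥0∞) [Fact (1 ≤ p)] [Fact (1 ≤ q)]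
    (hpq : p⁻¹ + q⁻¹ = 1) (Λ : Set ℕ) (hΛ : IsMuntzSzasz (-1) 1 Λ)
    (θ : ℝ) (hθ : θ ∈ Set.Ico (0 : ℝ) 1) :
    (cosClosedSpan 𝕜 p Λ θ : Set (XSpace 𝕜 p)) = evenAbout 𝕜 p θ ∧
      cosAnnihilator 𝕜 q Λ θ = oddAbout 𝕜 q θ :=
  ⟨(cosClosedSpan_subset_evenAbout p).antisymm (evenAbout_subset_cosClosedSpan p hΛ hθ),
    (cosAnnihilator_subset_oddAbout q hΛ hθ).antisymm (oddAbout_subset_cosAnnihilator q)⟩
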